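/- Consider finite (possibly empty) sequences $(\lambda_1,\dots,\lambda_s)$ of non-negative integers, each colored $a$, $b$ or $u$, in which the final occurrence of a positive colored part may be overlined (so $0$ is never overlined), such that $\lambda_s\notin\{0_a,0_b,\overline 1_a,\overline 1_b\}$ and such that for $1\le i<s$ the difference $\lambda_i-\lambda_{i+1}$ is at least the entry in row $\lambda_i$ and column $\lambda_{i+1}$ of $$ \begin{array}{c|cccccc} & \overline a & \overline b & \overline u & a & b & u\\ \hline \overline a & 2&0&2&2&0&2\\ \overline b & 2&2&3&2&2&3\\ \overline u & 1&0&1&1&0&1\\ a & 1&-1&1&1&-1&1\\ b & 1&1&2&1&1&2\\ u & 0&-1&0&0&-1&0 \end{array} $$ Here $x$ (resp. $\overline{x}$) stands for a non-overlined (resp. overlined) part of color $x$. Let $\overline{C}_3(n;k;i,j)$ be the number of such sequences with sum $n$, with $k$ non-overlined parts, $i$ parts colored $a$ and $j$ parts colored $b$, in which moreover the final $t$ parts are all overlined, where $t$ is the number of parts colored $u$. Then, as formal power series in $a,b,d,q$ (with convergence of the infinite sum and product coefficientwise), $$ \sum_{n,k,i,j\ge 0}\overline{C}_3(n;k;i,j)\,a^ib^jd^kq^n=(-q)_\infty\sum_{r,s\ge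 0}\frac{q^{r^2+r+s^2+s-\binom{r+s+1}{2}}\,a^rb^s\,d^{r+s}(-q/d)_{r+s}}{(q^2;q^2)_r\,(q^2;q^2)_s}, $$ where $(x;q)_n=\prod_{k=0}^{n-1}(1-xq^k)$ for $n\in\mathbb{N}\cup\{\infty\}$, $(x)_n=(x;q)_n$, and $d^{m}(-q/d)_{m}$ denotes the polynomial $\prod_{k=1}^{m}(d+q^k)$. -/

import Mathlib

open scoped MvPowerSeries.WithPiTopology

namespace JaggedOverpartition

/-- The three colors of parts. -/
inductive Color
  | a
  | b
  | u
  deriving DecidableEq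

/-- A colored non-negative integer, overlined or not. -/
structure Part where
  size : ℕ
  color : Color
  overlined : Bool

/-- The minimal differences `λ_i - λ_{i+1}` when `λ_i` is overlined; rows: color of `λ_i`,
columns: color of `λ_{i+1}`. -/
def overDiff : Color → Color → ℤ
  | .a, .a => 2
  | .a, .b => 0
  | .a, .u => 2
  | .b, .a => 2
  | .b, .b => 2
  | .b, .u => 3
  | .u, .a => 1
  | .u, .b => 0
  | .u, .u => 1

/-- The minimal differences `λ_i - λ_{i+1}` when `λ_i` is not overlined. -/
def plainDiff : Color → Color → ℤ
  | .a, .a => 1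
  | .a, .b => -1
  | .a, .u => 1
  | .b, .a => 1
  | .b, .b => 1
  | .b, .u => 2
  | .u, .a => 0
  | .u, .b => -1
  | .u, .u => 0

/-- The entry `(x, y)` of the `6 × 6` difference matrix. It does not depend on whether the second
part is overlined. -/
def minDiff (x y : Part) : ℤ :=
  if x.overlined then overDiff x.color y.color else plainDiff x.color y.color

/-- Jagged overpartitions `(λ_1, …, λ_s)`, as lists with `λ_1` first. The final occurrence
of a part is meant for colored integers: `5_a` and `5_b` are different parts. -/
structure IsJaggedOverpartition (l : List Part) : Prop where
  /-- only positive parts are overlined -/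
  over_pos : ∀ x ∈ l, x.overlined = true → 0 < x.size
  /-- only the final occurrence of a part is overlined -/
  over_final : l.Pairwise fun x y => x.overlined = true → ¬ (y.size = x.size ∧ y.color = x.color)
  /-- the final part is none of `0_a`, `0_b`, overlined `1_a`, overlined `1_b` -/
  last_ne : ∀ x ∈ l.getLast?,
    x ≠ ⟨0, .a, false⟩ ∧ x ≠ ⟨0, .b, false⟩ ∧ x ≠ ⟨1, .a, true⟩ ∧ x ≠ ⟨1, .b, true⟩
  /-- successive parts satisfy the difference conditions -/
  diff : l.IsChain fun x y => minDiff x y ≤ (x.size : ℤ) - (y.size : ℤ)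

/-- The sum of the parts. -/
def weight (l : List Part) : ℕ := (l.map Part.size).sum

/-- The number of parts of color `c`, overlined or not. -/
def colorCount (c : Color) (l : List Part) : ℕ := l.countP fun x => decide (x.color = c)

/-- The number of non-overlined parts. -/
def plainCount (l : List Part) : ℕ := l.countP fun x => !x.overlined

/-- The final `t` parts are overlined, where `t` is the number of parts of color `u`. -/
def FinalPartsOverlined (l : List Part) : Prop :=
  ∀ x ∈ l.drop (l.length - colorCount .u l), x.overlined = true

/-- The jagged overpartitions of `n` with `k` non-overlined parts, `i` parts colored `a` and `j`
parts colored `b`. -/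
def jaggedSet (n k i j : ℕ) : Set (List Part) :=
  {l | IsJaggedOverpartition l ∧ weight l = n ∧ plainCount l = k ∧
    colorCount .a l = i ∧ colorCount .b l = j}

/-- Those jagged overpartitions whose final `t` parts are overlined, `t` being the number of
`u`-parts. -/
def jaggedSet₃ (n k i j : ℕ) : Set (List Part) :=
  {l | l ∈ jaggedSet n k i j ∧ FinalPartsOverlined l}

lemma length_le (l : List Part) (h : ∀ x ∈ l, x.overlined = true → 0 < x.size) :
    l.length ≤ weight l + plainCount l := by
  induction l with
  | nil => simp
  | cons x l ih =>
    have h1 := ih fun y hy => h y (List.mem_cons_of_mem _ hy)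
    have h2 := h x List.mem_cons_self
    cases hx : x.overlined <;> simp_all [weight, plainCount] <;> omega

/-- The sets that are counted are finite. -/
lemma finite_jaggedSet (n k i j : ℕ) : (jaggedSet n k i j).Finite := by
  let f : Fin (n + 1) × Color × Bool → Part := fun p => ⟨p.1, p.2.1, p.2.2⟩
  have : Finite Color := by
    refine Finite.of_surjective (fun m : Fin 3 => ![Color.a, Color.b, Color.u] m) ?_
    rintro (_ | _ | _)
    exacts [⟨0, rfl⟩, ⟨1, rfl⟩, ⟨2, rfl⟩]
  refine ((List.finite_length_le (Fin (n + 1) × Color × Bool) (n + k)).image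
    (List.map f)).subset ?_
  rintro l ⟨hl, hn, hk, -, -⟩
  have hlen : l.length ≤ n + k := hn ▸ hk ▸ length_le l hl.over_pos
  have hsize : ∀ x ∈ l, x.size ≤ n := fun x hx =>
    hn ▸ List.single_le_sum (by simp) _ (List.mem_map_of_mem hx)
  have hmem : l ∈ Set.range (List.map f) := by
    rw [Set.range_list_map]
    intro x hx
    exact ⟨(⟨x.size, Nat.lt_succ_of_le (hsize x hx)⟩, x.color, x.overlined), rfl⟩
  obtain ⟨l', rfl⟩ := hmem
  exact ⟨l', by simpa using hlen, rfl⟩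

lemma finite_jaggedSet₃ (n k i j : ℕ) : (jaggedSet₃ n k i j).Finite :=
  (finite_jaggedSet n k i j).subset fun _ h => h.1

/-- The number of jagged overpartitions in `jaggedSet₃ n k i j`. -/
noncomputable def count₃ (n k i j : ℕ) : ℕ := (jaggedSet₃ n k i j).ncard

/-- The four indeterminates. -/
inductive Var
  | a
  | b
  | d
  | q

/-- Formal power series in `a, b, d, q` over `ℤ`, with the topology of coefficientwise
convergence. -/
abbrev Series := MvPowerSeries Var ℤ

/-- An indeterminate, as a power series. -/
noncomputable abbrev var (v : Var) : Series := MvPowerSeries.X v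

/-- The generating function `∑ count₃ n k i j * a ^ i * b ^ j * d ^ k * q ^ n`. -/
noncomputable def genFun₃ : Series :=
  fun e => (count₃ (e .q) (e .d) (e .a) (e .b) : ℤ)

section qPochhammer

variable {A : Type*} [CommRing A]

/-- The factors of the `q`-Pochhammer symbols `(x; q)_n` and `(x; q)_∞`. -/
def qFactor (x q : A) (k : ℕ) : A := 1 - x * q ^ k

/-- `(x; q)_n = ∏_{k=0}^{n-1} (1 - x q^k)`. -/
def qPoch (x q : A) (n : ℕ) : A := ∏ k ∈ Finset.range n, qFactor x q k

/-- `(x; q)_∞ = ∏_{k ≥ 0} (1 - x q^k)`. -/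
noncomputable def qPochInf [TopologicalSpace A] (x q : A) : A := ∏' k : ℕ, qFactor x q k

/-- `d^n (x/d; q)_n`, multiplied out so that it makes sense without inverting `d`. -/
def qPochScaled (d x q : A) (n : ℕ) : A := ∏ k ∈ Finset.range n, (d - x * q ^ k)

lemma qPochScaled_eq {A : Type*} [Field A] {d : A} (hd : d ≠ 0) (x q : A) (n : ℕ) :
    qPochScaled d x q n = d ^ n * qPoch (x / d) q n := by
  rw [qPochScaled, qPoch, ← Finset.card_range n, ← Finset.prod_const, Finset.card_range,
    ← Finset.prod_mul_distrib]
  refine Finset.prod_congr rfl fun k _ => ?_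
  rw [qFactor]
  field_simp

end qPochhammer

/-- The denominators of `summand` are invertible power series. -/
lemma isUnit_qPoch (r : ℕ) : IsUnit (qPoch (var .q ^ 2) (var .q ^ 2) r) := by
  rw [MvPowerSeries.isUnit_iff_constantCoeff, qPoch, map_prod]
  simp [qFactor]

/-- The exponent of `q` in `summand` is a difference of natural numbers that does not truncate. -/
lemma choose_le_exponent (r s : ℕ) : (r + s + 1).choose 2 ≤ r ^ 2 + r + s ^ 2 + s := by
  rw [Nat.choose_two_right]
  apply Nat.div_le_of_le_mul
  simp only [Nat.add_sub_cancel]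
  zify
  nlinarith [sq_nonneg ((r : ℤ) - s)]

/-- The `(r, s)` term of the double sum. -/
noncomputable def summand (p : ℕ × ℕ) : Series :=
  var .q ^ (p.1 ^ 2 + p.1 + p.2 ^ 2 + p.2 - (p.1 + p.2 + 1).choose 2) *
    var .a ^ p.1 * var .b ^ p.2 *
    qPochScaled (var .d) (-var .q) (var .q) (p.1 + p.2) *
    Ring.inverse (qPoch (var .q ^ 2) (var .q ^ 2) p.1 * qPoch (var .q ^ 2) (var .q ^ 2) p.2)

end JaggedOverpartition

/-! Lower every part of color `b` by one and call the result its level. The difference matrix then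
turns into the 0/1 matrix `levelDiff`, plus one when the upper part is overlined (`minDiff_eq`). If
the empty sequence is read as `0_a`, the condition on the last part has the same shape, and the
overlining rules become automatic. A jagged overpartition is therefore a free choice, for each part,
of a color, an overline and an excess over the minimal difference (`decode`). Whatever is added to
the difference at position `k` raises the first `k` parts. So for a fixed color word, position `k`
contributes `(q^k + d)/(1 - q^k)`, without `d` among the final `t` positions, and the word
contributes `q ^ wordStat` and its color weights (`hasSum_codeTerm_fiber`). Summing `q ^ wordStat`
over the words with `r`, `s`, `t` letters `a`, `b`, `u` gives a product (`scaledWordSum_closed`).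
Its factor `(q)_{r+s+t}` cancels against the position factors (`contentTerm_eq`), and the remaining
sum over `t` is Euler's expansion of `(-q^{r+s+1})_∞`, which `(-q)_{r+s}` completes to `(-q)_∞`. -/

namespace JaggedOverpartition

open Filter Topology

/-! ### Pochhammer recursion and invertible or nonzero series. -/

section qPochhammer

variable {A : Type*} [CommRing A]

lemma qPoch_zero (x q : A) : qPoch x q 0 = 1 := by simp [qPoch]

lemma qPoch_succ (x q : A) (n : ℕ) : qPoch x q (n + 1) = qPoch x q n * (1 - x * q ^ n) := by
  rw [qPoch, Finset.prod_range_succ]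
  rfl

end qPochhammer

lemma var_q_ne_zero : var .q ≠ 0 := by
  intro h
  have := congrArg (MvPowerSeries.coeff (Finsupp.single Var.q 1)) h
  rw [MvPowerSeries.coeff_index_single_self_X, map_zero] at this
  exact one_ne_zero this

lemma isUnit_one_sub_q_pow {k : ℕ} (hk : k ≠ 0) : IsUnit (1 - var .q ^ k) := by
  rw [MvPowerSeries.isUnit_iff_constantCoeff]
  simp [hk]

lemma one_add_q_pow_ne_zero (k : ℕ) : 1 + var .q ^ k ≠ 0 := by
  intro h
  have := congrArg MvPowerSeries.constantCoeff h
  rcases eq_or_ne k 0 with rfl | hk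
  · simp at this
  · simp [hk] at this

lemma isUnit_qPoch_q (n : ℕ) : IsUnit (qPoch (var .q) (var .q) n) := by
  rw [MvPowerSeries.isUnit_iff_constantCoeff, qPoch, map_prod]
  simp [qFactor]

/-! ### Convergence of power series in `q`. -/

section Topology

lemma nonarchimedeanRing_int : NonarchimedeanRing ℤ where
  is_nonarchimedean U hU :=
    ⟨⟨⊥, isOpen_discrete _⟩, fun x hx => by
      have hx' : x = 0 := hx
      exact hx' ▸ mem_of_mem_nhds hU⟩

/-- Sums of formal power series with integer coefficients can be multiplied. -/
lemma hasSum_mul {σ ι κ : Type*} {f : ι → MvPowerSeries σ ℤ} {g : κ → MvPowerSeries σ ℤ}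
    {x y : MvPowerSeries σ ℤ} (hf : HasSum f x) (hg : HasSum g y) :
    HasSum (fun p : ι × κ => f p.1 * g p.2) (x * y) := by
  classical
  have := nonarchimedeanRing_int
  rw [MvPowerSeries.WithPiTopology.hasSum_iff_hasSum_coeff] at *
  intro e
  simp only [MvPowerSeries.coeff_mul]
  exact hasSum_sum fun p _ => (hf p.1).mul_of_nonarchimedean (hg p.2)

lemma coeff_q_pow_mul {k : ℕ} {e : Var →₀ ℕ} (h : e .q < k) (f : Series) :
    MvPowerSeries.coeff e (var .q ^ k * f) = 0 :=
  MvPowerSeries.X_pow_dvd_iff.1 (Dvd.intro f rfl) e h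

lemma summable_q_pow_mul {k : ℕ → ℕ} (hk : ∀ n, n ≤ k n) (f : ℕ → Series) :
    Summable fun n => var .q ^ k n * f n := by
  rw [MvPowerSeries.WithPiTopology.summable_iff_summable_coeff]
  intro e
  refine summable_of_hasFiniteSupport ((Set.finite_Iic (e .q)).subset fun n hn => ?_)
  by_contra h
  exact hn (coeff_q_pow_mul ((not_le.1 h).trans_le (hk n)) _)

lemma hasSum_q_pow_geometric {k : ℕ} (hk : k ≠ 0) :
    HasSum (fun f : ℕ => var .q ^ (k * f)) (Ring.inverse (1 - var .q ^ k)) := by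
  have hs : Summable fun f : ℕ => var .q ^ (k * f) := by
    simpa using summable_q_pow_mul (k := fun f => k * f)
      (fun n => Nat.le_mul_of_pos_left n (Nat.pos_of_ne_zero hk)) fun _ => 1
  have h0 : MvPowerSeries.constantCoeff (var .q ^ k) = 0 := by simp [hk]
  have h := MvPowerSeries.WithPiTopology.one_sub_mul_tsum_pow_of_constantCoeff_eq_zero h0
  simp only [← pow_mul] at h
  have hu := isUnit_one_sub_q_pow hk
  convert hs.hasSum using 1
  apply hu.mul_left_cancel
  rw [Ring.mul_inverse_cancel _ hu, h]

end Topology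

/-! ### Euler's expansion of `(-q^{m+1})_∞`. -/

section Euler

lemma multipliable_qFactor : Multipliable (qFactor (-var .q) (var .q)) := by
  have : qFactor (-var .q) (var .q) = fun k => 1 + var .q ^ (k + 1) := by
    funext k
    simp only [qFactor]
    ring
  rw [this]
  apply MvPowerSeries.WithPiTopology.multipliable_one_add_of_tendsto_order_atTop_nhds_top
  refine tendsto_order.2 ⟨fun a ha => ?_, fun a ha => (not_top_lt ha).elim⟩
  lift a to ℕ using ha.ne
  filter_upwards [eventually_ge_atTop a] with k hk
  refine lt_of_lt_of_le ?_ (MvPowerSeries.le_order_pow (k + 1))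
  have h : (1 : ℕ∞) ≤ MvPowerSeries.order (var .q) :=
    MvPowerSeries.one_le_order_iff_constCoeff_eq_zero.2 (by simp)
  calc (a : ℕ∞) < ((k + 1 : ℕ) : ℕ∞) := by exact_mod_cast Nat.lt_succ_of_le hk
    _ = (k + 1) • (1 : ℕ∞) := by simp
    _ ≤ _ := nsmul_le_nsmul_right h _

/-- The terms of Euler's expansion of `(-q ^ (m + 1); q)_∞`. -/
noncomputable def eulerTerm (m t : ℕ) : Series :=
  var .q ^ ((t + 1).choose 2 + m * t) * Ring.inverse (qPoch (var .q) (var .q) t)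

lemma le_choose_two (t : ℕ) : t ≤ (t + 1).choose 2 := by
  rw [Nat.choose_succ_succ' t 1]
  simp

lemma summable_eulerTerm (m : ℕ) : Summable (eulerTerm m) :=
  summable_q_pow_mul (fun t => (le_choose_two t).trans (Nat.le_add_right _ _)) _

lemma eulerTerm_zero (m : ℕ) : eulerTerm m 0 = 1 := by
  simp [eulerTerm, qPoch_zero]

/-- Split `1 = q^{t+1} + (1 - q^{t+1})`: the first piece raises `m` by one, the second cancels the
last factor of `(q)_{t+1}`. -/
lemma eulerTerm_succ (m t : ℕ) :
    eulerTerm m (t + 1) = eulerTerm (m + 1) (t + 1) + var .q ^ (m + 1) * eulerTerm (m + 1) t := by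
  have h1 := isUnit_qPoch_q t
  have h2 := isUnit_qPoch_q (t + 1)
  have h3 : Ring.inverse (qPoch (var .q) (var .q) t) =
      Ring.inverse (qPoch (var .q) (var .q) (t + 1)) * (1 - var .q * var .q ^ t) := by
    apply h1.mul_left_cancel
    rw [Ring.mul_inverse_cancel _ h1, mul_comm (Ring.inverse _), ← mul_assoc, ← qPoch_succ,
      Ring.mul_inverse_cancel _ h2]
  have h4 : (t + 1 + 1).choose 2 = (t + 1).choose 2 + (t + 1) := by
    rw [Nat.choose_succ_succ' (t + 1) 1]
    simp [add_comm]
  simp only [eulerTerm, h3, h4]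
  ring

lemma tsum_eulerTerm_succ (m : ℕ) :
    ∑' t, eulerTerm m t = (1 + var .q ^ (m + 1)) * ∑' t, eulerTerm (m + 1) t := by
  have hs := summable_eulerTerm m
  have hs' := summable_eulerTerm (m + 1)
  have h1 : Summable fun t => eulerTerm (m + 1) (t + 1) :=
    hs'.comp_injective (add_left_injective 1)
  rw [hs.tsum_eq_zero_add, add_mul, one_mul]
  simp only [eulerTerm_succ m]
  rw [h1.tsum_add (hs'.mul_left _), hs'.tsum_mul_left, ← add_assoc]
  rw [eulerTerm_zero, hs'.tsum_eq_zero_add, eulerTerm_zero]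

lemma qPoch_mul_tsum_eulerTerm (m : ℕ) :
    qPoch (-var .q) (var .q) m * ∑' t, eulerTerm m t = ∑' t, eulerTerm 0 t := by
  induction m with
  | zero => rw [qPoch_zero, one_mul]
  | succ m ih =>
    rw [← ih, tsum_eulerTerm_succ m, qPoch_succ]
    ring

lemma tendsto_tsum_eulerTerm : Tendsto (fun m => ∑' t, eulerTerm m t) atTop (𝓝 1) := by
  rw [MvPowerSeries.WithPiTopology.tendsto_iff_coeff_tendsto]
  intro e
  refine tendsto_const_nhds.congr' ?_
  filter_upwards [eventually_gt_atTop (e .q)] with m hm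
  have h1 := (MvPowerSeries.WithPiTopology.hasSum_iff_hasSum_coeff).1
    (summable_eulerTerm m).hasSum e
  refine HasSum.unique ?_ h1
  rw [← eulerTerm_zero m]
  refine hasSum_single 0 fun t ht => coeff_q_pow_mul (hm.trans_le ?_) _
  exact (Nat.le_mul_of_pos_right m (Nat.pos_of_ne_zero ht)).trans (Nat.le_add_left _ _)

/-- The product of `(-q)_m` and the sum of `eulerTerm m` does not depend on `m`. As `m → ∞`, the sum
tends to 1. -/
lemma tsum_eulerTerm_zero : ∑' t, eulerTerm 0 t = qPochInf (-var .q) (var .q) := by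
  have h1 := multipliable_qFactor.hasProd.tendsto_prod_nat
  have h2 := h1.mul tendsto_tsum_eulerTerm
  rw [mul_one] at h2
  refine tendsto_nhds_unique (tendsto_const_nhds.congr fun m => ?_) h2
  exact (qPoch_mul_tsum_eulerTerm m).symm

lemma hasSum_eulerTerm (m : ℕ) :
    HasSum (fun t => qPoch (-var .q) (var .q) m * eulerTerm m t)
      (qPochInf (-var .q) (var .q)) := by
  rw [← tsum_eulerTerm_zero, ← qPoch_mul_tsum_eulerTerm m]
  exact (summable_eulerTerm m).hasSum.mul_left _

/-- Allows the summability of the double sum to be recovered from that of its multiple by `(-q)_∞`.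
-/
lemma isUnit_qPochInf : IsUnit (qPochInf (-var .q) (var .q)) := by
  rw [MvPowerSeries.isUnit_iff_constantCoeff, ← tsum_eulerTerm_zero]
  have h1 := (MvPowerSeries.WithPiTopology.hasSum_iff_hasSum_coeff).1
    (summable_eulerTerm 0).hasSum 0
  have h2 : HasSum (fun t => MvPowerSeries.coeff 0 (eulerTerm 0 t)) (1 : ℤ) := by
    convert hasSum_single (f := fun t => MvPowerSeries.coeff 0 (eulerTerm 0 t)) 0 fun t ht => ?_
    · rw [eulerTerm_zero]
      simp
    · refine coeff_q_pow_mul (lt_of_lt_of_le ?_ (Nat.le_add_right _ _)) _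
      exact (Nat.pos_of_ne_zero ht).trans_le (le_choose_two t)
  rw [← MvPowerSeries.coeff_zero_eq_constantCoeff_apply, h1.unique h2]
  exact isUnit_one

end Euler

/-! ### Jagged overpartitions as unconstrained lists of codes. -/

section Decode

/-- A part is recorded by its color, whether it is overlined, and the amount by which its
difference to the next part exceeds the minimal one. -/
abbrev Code := Color × Bool × ℕ

/-- The least size of a part of the given color in a jagged overpartition. -/
def bShift : Color → ℕ
  | .b => 1
  | _ => 0

/-- The minimal difference of the levels of successive non-overlined parts. -/
def levelDiff : Color → Color → ℕ
  | .a, .a => 1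
  | .a, .u => 1
  | .b, .b => 1
  | .b, .u => 1
  | _, _ => 0

/-- The negative entries of the matrix come only from the coboundary of `bShift`, which passing to
levels removes. -/
lemma minDiff_eq (x y : Part) :
    minDiff x y = levelDiff x.color y.color + bShift x.color - bShift y.color
      + x.overlined.toNat := by
  obtain ⟨n, c, o⟩ := x
  obtain ⟨n', c', o'⟩ := y
  cases c <;> cases c' <;> cases o <;> simp [minDiff, overDiff, plainDiff, levelDiff, bShift]

/-- The size of a part, lowered by one for color `b`. -/
def level (x : Part) : ℕ := x.size - bShift x.color

/-- The first part; the empty sequence counts as starting with `0_a`. -/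
def headPart (l : List Part) : Part := l.headD ⟨0, .a, false⟩

@[simp] lemma headPart_nil : headPart [] = ⟨0, .a, false⟩ := rfl

@[simp] lemma headPart_cons (x : Part) (l : List Part) : headPart (x :: l) = x := rfl

lemma IsJaggedOverpartition.tail {x : Part} {l : List Part}
    (h : IsJaggedOverpartition (x :: l)) : IsJaggedOverpartition l where
  over_pos y hy := h.over_pos y (List.mem_cons_of_mem _ hy)
  over_final := (List.pairwise_cons.1 h.over_final).2
  last_ne := by
    cases l with
    | nil => simp
    | cons y l => simpa only [List.getLast?_cons_cons] using h.last_ne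
  diff := h.diff.tail

lemma IsJaggedOverpartition.bShift_le_head {l : List Part} (h : IsJaggedOverpartition l) :
    bShift (headPart l).color ≤ (headPart l).size := by
  induction l with
  | nil => simp [bShift]
  | cons x l ih =>
    have h1 := ih h.tail
    cases l with
    | nil =>
      have h2 := h.last_ne x (by simp)
      obtain ⟨n, c, o⟩ := x
      have h3 := h.over_pos _ List.mem_cons_self
      cases c <;> simp [bShift] at *
      cases o <;> simp at * <;> omega
    | cons y l =>
      have h2 := (List.isChain_cons_cons.1 h.diff).1
      rw [minDiff_eq] at h2
      simp only [headPart_cons] at *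
      omega

lemma isJaggedOverpartition_nil : IsJaggedOverpartition [] := by
  constructor <;> simp

/-- For a single part, the comparison with `0_a` encodes exactly the excluded last parts and the
positivity of overlined parts. -/
lemma IsJaggedOverpartition.head_ge {x : Part} {l : List Part}
    (h : IsJaggedOverpartition (x :: l)) :
    level (headPart l) + levelDiff x.color (headPart l).color + x.overlined.toNat
      + bShift x.color ≤ x.size := by
  cases l with
  | nil =>
    have h2 := h.last_ne x (by simp)
    obtain ⟨n, c, o⟩ := x
    have h3 := h.over_pos _ List.mem_cons_self
    cases c <;> cases o <;> simp [bShift, levelDiff, level] at * <;> omega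
  | cons y l =>
    have h2 := (List.isChain_cons_cons.1 h.diff).1
    have h3 := h.tail.bShift_le_head
    rw [minDiff_eq] at h2
    simp only [headPart_cons, level] at *
    omega

lemma IsJaggedOverpartition.level_le_head {l : List Part} (h : IsJaggedOverpartition l) :
    ∀ y ∈ l, level y ≤ level (headPart l) := by
  induction l with
  | nil => simp
  | cons x l ih =>
    intro y hy
    have h1 := h.head_ge
    rcases List.mem_cons.1 hy with rfl | hy
    · simp
    · have h2 := ih h.tail y hy
      rw [headPart_cons]
      refine h2.trans ?_
      simp only [level] at *
      omega

/-- Levels never increase along the sequence, and drop strictly after an overlined part. Hence the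
same colored integer cannot recur after it. -/
lemma IsJaggedOverpartition.cons {x : Part} {l : List Part} (h : IsJaggedOverpartition l)
    (hx : level (headPart l) + levelDiff x.color (headPart l).color + x.overlined.toNat
      + bShift x.color ≤ x.size) : IsJaggedOverpartition (x :: l) where
  over_pos y hy := by
    rcases List.mem_cons.1 hy with rfl | hy
    · intro ho
      simp only [ho, Bool.toNat_true] at hx
      omega
    · exact h.over_pos y hy
  over_final := by
    refine List.pairwise_cons.2 ⟨fun y hy ho hyx => ?_, h.over_final⟩
    have h1 := h.level_le_head y hy
    rw [level, hyx.1, hyx.2] at h1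
    simp only [ho, Bool.toNat_true] at hx
    omega
  last_ne := by
    cases l with
    | nil =>
      intro y hy
      obtain rfl : x = y := by simpa using hy
      refine ⟨?_, ?_, ?_, ?_⟩ <;> rintro rfl <;> simp [level, levelDiff, bShift] at hx
    | cons y l => simpa only [List.getLast?_cons_cons] using h.last_ne
  diff := by
    cases l with
    | nil => simp
    | cons y l =>
      refine List.isChain_cons_cons.2 ⟨?_, h.diff⟩
      have h1 := h.bShift_le_head
      rw [minDiff_eq]
      simp only [headPart_cons, level] at *
      omega

/-- The sequence of parts recorded by a list of codes. -/
def decode : List Code → List Part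
  | [] => []
  | (c, o, f) :: cs =>
    ⟨level (headPart (decode cs)) + levelDiff c (headPart (decode cs)).color + o.toNat
      + bShift c + f, c, o⟩ :: decode cs

lemma decode_injective : Function.Injective decode := by
  intro cs
  induction cs with
  | nil =>
    rintro (_ | ⟨z, cs'⟩) h
    · rfl
    · simp [decode] at h
  | cons z cs ih =>
    rintro (_ | ⟨z', cs'⟩) h
    · simp [decode] at h
    · obtain ⟨c, o, f⟩ := z
      obtain ⟨c', o', f'⟩ := z'
      simp only [decode, List.cons.injEq, Part.mk.injEq] at h
      obtain ⟨⟨h1, rfl, rfl⟩, h2⟩ := h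
      obtain rfl := ih h2
      simpa using h1

lemma isJaggedOverpartition_decode (cs : List Code) : IsJaggedOverpartition (decode cs) := by
  induction cs with
  | nil => exact isJaggedOverpartition_nil
  | cons z cs ih => exact ih.cons (Nat.le_add_right _ _)

lemma IsJaggedOverpartition.exists_decode {l : List Part} (h : IsJaggedOverpartition l) :
    ∃ cs, decode cs = l := by
  induction l with
  | nil => exact ⟨[], rfl⟩
  | cons x l ih =>
    obtain ⟨cs, rfl⟩ := ih h.tail
    obtain ⟨f, hf⟩ := Nat.exists_eq_add_of_le h.head_ge
    exact ⟨(x.color, x.overlined, f) :: cs, by simp only [decode, ← hf]⟩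

end Decode

/-! ### Monomials of sequences in terms of their codes. -/

section Term

/-- The monomial `a ^ i * b ^ j * d ^ k * q ^ n` counted by a sequence of parts. -/
noncomputable def partsMonomial (l : List Part) : Series :=
  var .q ^ weight l * var .d ^ plainCount l * var .a ^ colorCount .a l * var .b ^ colorCount .b l

open Classical in
lemma coeff_partsMonomial (l : List Part) (e : Var →₀ ℕ) :
    MvPowerSeries.coeff e (partsMonomial l) =
      if weight l = e .q ∧ plainCount l = e .d ∧ colorCount .a l = e .a ∧ colorCount .b l = e .b
      then 1 else 0 := by
  simp only [partsMonomial, var, MvPowerSeries.X_pow_eq, MvPowerSeries.monomial_mul_monomial,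
    mul_one, MvPowerSeries.coeff_monomial]
  congr 1
  rw [eq_iff_iff, Finsupp.ext_iff]
  constructor
  · intro h
    have hq := h .q
    have hd := h .d
    have ha := h .a
    have hb := h .b
    simp at hq hd ha hb
    exact ⟨hq.symm, hd.symm, ha.symm, hb.symm⟩
  · rintro ⟨h1, h2, h3, h4⟩ (_ | _ | _ | _) <;> simp [*]

open Classical in
lemma hasSum_partsMonomial :
    HasSum (fun l => if IsJaggedOverpartition l ∧ FinalPartsOverlined l then partsMonomial l else 0)
      genFun₃ := by
  rw [MvPowerSeries.WithPiTopology.hasSum_iff_hasSum_coeff]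
  intro e
  have hfin := finite_jaggedSet₃ (e .q) (e .d) (e .a) (e .b)
  have h1 : MvPowerSeries.coeff e genFun₃ = ∑ l ∈ hfin.toFinset, (1 : ℤ) := by
    rw [Finset.sum_const, ← Set.ncard_eq_toFinset_card _ hfin]
    simp only [nsmul_eq_mul, mul_one]
    rfl
  rw [h1]
  have h2 : ∀ l, MvPowerSeries.coeff e
      (if IsJaggedOverpartition l ∧ FinalPartsOverlined l then partsMonomial l else 0) =
      if l ∈ hfin.toFinset then 1 else 0 := by
    intro l
    simp only [Set.Finite.mem_toFinset, jaggedSet₃, jaggedSet, Set.mem_ofPred_eq]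
    rw [apply_ite (MvPowerSeries.coeff e), coeff_partsMonomial, map_zero, ← ite_and]
    congr 1
    rw [eq_iff_iff]
    tauto
  simp only [h2]
  rw [Finset.sum_congr rfl fun l hl => (if_pos hl).symm]
  exact hasSum_sum_of_ne_finset_zero fun l hl => if_neg hl

/-- The factor contributed by the color of a part. -/
noncomputable def colorWeight : Color → Series
  | .a => var .a
  | .b => var .b * var .q
  | .u => 1

/-- The factor contributed to the monomial of `decode cs` by a list `cs` of codes whose first entry
has position `k`, or zero if a non-overlined part has position greater than `m`. -/
noncomputable def codeTerm (m : ℕ) : ℕ → List Code → Series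
  | _, [] => 1
  | k, (c, o, f) :: cs =>
    var .q ^ (k * levelDiff c ((cs.map Prod.fst).headD .a)) * colorWeight c *
      ((if o then var .q ^ k else if k ≤ m then var .d else 0) * var .q ^ (k * f)) *
      codeTerm m (k + 1) cs

lemma color_headPart_decode (cs : List Code) :
    (headPart (decode cs)).color = (cs.map Prod.fst).headD .a := by
  cases cs <;> rfl

-- The `k` parts before this tail all rest on the level of its head, whence the factor `q ^ (k *
-- level)`. Dropping `m - k` parts of the tail leaves those whose position in the whole sequence
-- exceeds `m`.
open Classical in
lemma codeTerm_eq (m k : ℕ) (cs : List Code) :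
    codeTerm m (k + 1) cs =
      if ∀ x ∈ (decode cs).drop (m - k), x.overlined = true then
        var .q ^ (k * level (headPart (decode cs))) * partsMonomial (decode cs) else 0 := by
  induction cs generalizing k with
  | nil => simp [codeTerm, decode, partsMonomial, weight, plainCount, colorCount, level]
  | cons z cs ih =>
    obtain ⟨c, o, f⟩ := z
    have hmk : (∀ x ∈ (decode ((c, o, f) :: cs)).drop (m - k), x.overlined = true) ↔
        (k + 1 ≤ m ∨ o = true) ∧ ∀ x ∈ (decode cs).drop (m - (k + 1)), x.overlined = true := by
      rcases Nat.lt_or_ge k m with h | h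
      · obtain ⟨j, rfl⟩ := Nat.exists_eq_add_of_lt h
        have h1 : k + j + 1 - k = j + 1 := by omega
        have h2 : k + j + 1 - (k + 1) = j := by omega
        rw [h1, h2, decode, List.drop_succ_cons]
        simp
      · have h1 : m - k = 0 := by omega
        have h2 : m - (k + 1) = 0 := by omega
        rw [h1, h2, decode, List.drop_zero, List.drop_zero]
        simp [Nat.not_lt.2 h, Nat.lt_iff_add_one_le.symm]
    simp only [hmk]
    rw [codeTerm, ih (k + 1), ← color_headPart_decode]
    by_cases h : ∀ x ∈ (decode cs).drop (m - (k + 1)), x.overlined = true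
    · simp only [eq_true h, and_true, if_true]
      simp only [decode, headPart_cons, partsMonomial, weight, plainCount, colorCount,
        List.map_cons, List.sum_cons, List.countP_cons]
      generalize level (headPart (decode cs)) = v
      cases o
      · by_cases hk : k + 1 ≤ m
        · cases c <;>
            simp [hk, bShift, level, colorWeight] <;> ring
        · simp [hk]
      · cases c <;>
          simp [bShift, level, colorWeight] <;> ring
    · simp [h]

end Term

/-! ### Summation over the codes with a fixed color word. -/

section Fiber

/-- The contribution of the minimal level differences to the weight of a sequence with colors `w`
that is followed by a part of color `y`, where the first color has position `k`. -/
def wordStat (y : Color) : ℕ → List Color → ℕ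
  | _, [] => 0
  | k, x :: w => k * levelDiff x (w.headD y) + wordStat y (k + 1) w

lemma wordStat_append (x y : Color) (k : ℕ) (w : List Color) :
    wordStat y k (w ++ [x]) = wordStat x k w + (k + w.length) * levelDiff x y := by
  induction w generalizing k with
  | nil => simp [wordStat]
  | cons z w ih =>
    have h : (w ++ [x]).headD y = w.headD x := by cases w <;> rfl
    rw [List.cons_append, wordStat, wordStat, ih, h, List.length_cons]
    ring

/-- The factor contributed by a part at position `k`, apart from its color. -/
noncomputable def positionFactor (m k : ℕ) : Series :=
  (var .q ^ k + if k ≤ m then var .d else 0) * Ring.inverse (1 - var .q ^ k)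

/-- With the colors fixed, the overline and the excess are chosen independently at each position, so
the sum factors. Each excess contributes a geometric series. -/
lemma hasSum_codeTerm_fiber (m : ℕ) {k : ℕ} (hk : k ≠ 0) (w : List Color) :
    HasSum (fun cs : {cs : List Code // cs.map Prod.fst = w} => codeTerm m k cs)
      (var .q ^ wordStat .a k w * (w.map colorWeight).prod *
        ∏ i ∈ Finset.range w.length, positionFactor m (k + i)) := by
  induction w generalizing k with
  | nil =>
    have : Unique {cs : List Code // cs.map Prod.fst = []} :=
      ⟨⟨⟨[], rfl⟩⟩, fun cs => Subtype.ext (List.map_eq_nil_iff.1 cs.2)⟩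
    convert hasSum_unique (fun cs : {cs : List Code // cs.map Prod.fst = []} => codeTerm m k cs)
    have h : (default : {cs : List Code // cs.map Prod.fst = []}).1 = [] :=
      List.map_eq_nil_iff.1 (default : {cs : List Code // cs.map Prod.fst = []}).2
    rw [h]
    simp [wordStat, codeTerm]
  | cons x w ih =>
    let e : (Bool × ℕ) × {cs : List Code // cs.map Prod.fst = w} →
        {cs : List Code // cs.map Prod.fst = x :: w} :=
      fun p => ⟨(x, p.1) :: p.2.1, by rw [List.map_cons, p.2.2]⟩
    have he : Function.Bijective e := by
      constructor
      · rintro ⟨p, cs, hcs⟩ ⟨p', cs', hcs'⟩ h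
        simp only [e, Subtype.mk.injEq, List.cons.injEq, Prod.mk.injEq, true_and] at h
        obtain ⟨rfl, rfl⟩ := h
        rfl
      · rintro ⟨_ | ⟨⟨x', p⟩, cs⟩, h⟩
        · simp at h
        · obtain ⟨rfl, h'⟩ := List.cons.inj h
          exact ⟨⟨p, cs, h'⟩, rfl⟩
    rw [← (Equiv.ofBijective e he).hasSum_iff]
    have h1 : HasSum (fun p : Bool × ℕ =>
        (if p.1 then var .q ^ k else if k ≤ m then var .d else 0) * var .q ^ (k * p.2))
        (positionFactor m k) := by
      have h := hasSum_mul (hasSum_fintype fun o : Bool =>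
        if o then var .q ^ k else if k ≤ m then var .d else 0) (hasSum_q_pow_geometric hk)
      simpa [positionFactor] using h
    have h2 := (hasSum_mul h1 (ih (Nat.succ_ne_zero k))).mul_left
      (var .q ^ (k * levelDiff x (w.headD .a)) * colorWeight x)
    convert! h2 using 1
    · funext p
      simp only [Function.comp_apply, Equiv.ofBijective_apply, e, codeTerm, p.2.2]
      ring
    · rw [List.length_cons, Finset.prod_range_succ', wordStat, pow_add, List.map_cons,
        List.prod_cons, add_zero]
      simp only [show ∀ i, k + (i + 1) = k.succ + i from fun i => by omega]
      ring

end Fiber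

/-! ### Words with given letter counts. -/

section Words

/-- The words with `r` letters `a`, `s` letters `b` and `t` letters `u`. -/
def wordSet (r s t : ℕ) : Set (List Color) :=
  {w | w.count .a = r ∧ w.count .b = s ∧ w.count .u = t}

lemma length_eq_count (w : List Color) :
    w.length = w.count .a + w.count .b + w.count .u := by
  induction w with
  | nil => rfl
  | cons x w ih => cases x <;> simp [ih] <;> omega

lemma finite_wordSet (r s t : ℕ) : (wordSet r s t).Finite := by
  have : Finite Color := by
    refine Finite.of_surjective (fun m : Fin 3 => ![Color.a, Color.b, Color.u] m) ?_
    rintro (_ | _ | _)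
    exacts [⟨0, rfl⟩, ⟨1, rfl⟩, ⟨2, rfl⟩]
  refine (List.finite_length_eq Color (r + s + t)).subset ?_
  rintro w ⟨rfl, rfl, rfl⟩
  exact length_eq_count w

/-- The generating function of `wordStat` over `wordSet r s t`. -/
noncomputable def wordSum (y : Color) (r s t : ℕ) : Series :=
  ∑' w : wordSet r s t, var .q ^ wordStat y 1 w

lemma hasSum_wordSum (y : Color) (r s t : ℕ) :
    HasSum (fun w : wordSet r s t => var .q ^ wordStat y 1 w) (wordSum y r s t) := by
  have := (finite_wordSet r s t).to_subtype
  exact (summable_of_hasFiniteSupport (Set.toFinite _)).hasSum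

lemma wordSum_zero (y : Color) : wordSum y 0 0 0 = 1 := by
  have h : wordSet 0 0 0 = {[]} := by
    ext w
    refine ⟨fun hw => ?_, fun hw => ?_⟩
    · have := length_eq_count w
      rw [hw.1, hw.2.1, hw.2.2] at this
      exact List.length_eq_zero_iff.1 this
    · rw [Set.mem_singleton_iff.1 hw]
      exact ⟨rfl, rfl, rfl⟩
  rw [wordSum, h, tsum_singleton [] fun w => var .q ^ wordStat y 1 w, wordStat, pow_zero]

/-- Splitting the words according to their last letter. -/
lemma wordSum_eq (y : Color) {r s t n : ℕ} (h : r + s + t = n + 1) :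
    wordSum y r s t =
      var .q ^ ((n + 1) * levelDiff .a y) * (if r = 0 then 0 else wordSum .a (r - 1) s t) +
      var .q ^ ((n + 1) * levelDiff .b y) * (if s = 0 then 0 else wordSum .b r (s - 1) t) +
      var .q ^ ((n + 1) * levelDiff .u y) * (if t = 0 then 0 else wordSum .u r s (t - 1)) := by
  -- `T x` is the word set with one letter `x` fewer, and is empty if there is none to remove.
  let T : Color → Set (List Color) := fun x => {w | w ++ [x] ∈ wordSet r s t}
  have hT : ∀ x, ∀ w ∈ T x, w.length = n := by
    intro x w hw
    have h1 := length_eq_count (w ++ [x])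
    rw [hw.1, hw.2.1, hw.2.2, List.length_append, List.length_singleton] at h1
    omega
  have hinj : ∀ x : Color, Function.Injective fun w : List Color => w ++ [x] :=
    fun x => List.append_left_injective [x]
  have hstep : ∀ x g, HasSum (fun w : T x => var .q ^ wordStat x 1 w) g →
      HasSum ((fun w => var .q ^ wordStat y 1 w) ∘ (Subtype.val : (fun w => w ++ [x]) '' T x → _))
        (var .q ^ ((n + 1) * levelDiff x y) * g) := by
    intro x g hg
    rw [← (Equiv.Set.image _ (T x) (hinj x)).hasSum_iff]
    convert! hg.mul_left (var .q ^ ((n + 1) * levelDiff x y)) using 1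
    funext w
    simp only [Function.comp_apply, Equiv.Set.image_apply, wordStat_append, hT x w.1 w.2]
    rw [← pow_add]
    congr 1
    ring
  have hsum : ∀ x ∈ ({.a, .b, .u} : Finset Color),
      HasSum ((fun w => var .q ^ wordStat y 1 w) ∘
        (Subtype.val : (fun w => w ++ [x]) '' T x → List Color))
      (var .q ^ ((n + 1) * levelDiff x y) * match x with
        | .a => if r = 0 then 0 else wordSum .a (r - 1) s t
        | .b => if s = 0 then 0 else wordSum .b r (s - 1) t
        | .u => if t = 0 then 0 else wordSum .u r s (t - 1)) := by
    intro x _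
    apply hstep
    cases x
    · rcases r with _ | r
      · have : T .a = ∅ := by
          ext w
          simp [T, wordSet]
        rw [this]
        exact hasSum_empty
      · have : T .a = wordSet r s t := by
          ext w
          simp [T, wordSet]
        rw [this]
        exact hasSum_wordSum _ _ _ _
    · rcases s with _ | s
      · have : T .b = ∅ := by
          ext w
          simp [T, wordSet]
        rw [this]
        exact hasSum_empty
      · have : T .b = wordSet r s t := by
          ext w
          simp [T, wordSet]
        rw [this]
        exact hasSum_wordSum _ _ _ _
    · rcases t with _ | t
      · have : T .u = ∅ := by
          ext w
          simp [T, wordSet]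
        rw [this]
        exact hasSum_empty
      · have : T .u = wordSet r s t := by
          ext w
          simp [T, wordSet]
        rw [this]
        exact hasSum_wordSum _ _ _ _
  have hdisj : (({.a, .b, .u} : Finset Color) : Set Color).Pairwise
      (Function.onFun Disjoint fun x => (fun w => w ++ [x]) '' T x) := by
    intro x _ x' _ hx
    refine Set.disjoint_left.2 ?_
    rintro _ ⟨w, -, rfl⟩ ⟨w', -, hw⟩
    exact hx (by simpa using (List.append_inj' hw rfl).2.symm)
  have hunion : ⋃ x ∈ ({.a, .b, .u} : Finset Color), (fun w => w ++ [x]) '' T x =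
      wordSet r s t := by
    ext w
    simp only [Set.mem_iUnion, Set.mem_image]
    constructor
    · rintro ⟨x, -, w, hw, rfl⟩
      exact hw
    · intro hw
      rcases List.eq_nil_or_concat w with rfl | ⟨w, x, rfl⟩
      · obtain ⟨rfl, rfl, rfl⟩ := hw
        simp at h
      · rw [List.concat_eq_append] at hw ⊢
        exact ⟨x, by cases x <;> simp, w, hw, rfl⟩
  have key := hasSum_sum_disjoint _ hdisj hsum
  rw [hunion] at key
  rw [HasSum.unique (hasSum_wordSum y r s t) key]
  simp [add_assoc]

end Words

/-! ### Product formula for the word sums. -/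

section ClosedForm

/-- `wordSum`, multiplied by the denominators of its closed form. -/
noncomputable def scaledWordSum (y : Color) (r s t : ℕ) : Series :=
  qPoch (var .q) (var .q) t * qPoch (var .q ^ 2) (var .q ^ 2) r *
    qPoch (var .q ^ 2) (var .q ^ 2) s * var .q ^ (r + s + 1).choose 2 * wordSum y r s t

/-- The factors `1 - q^{2r}`, `1 - q^{2s}` and `1 - q^t` come from the Pochhammer symbols. They
vanish exactly where the subtraction of a letter truncates, so no case distinction remains. The
extra `q^{r+s}` is the growth of the binomial exponent. -/
lemma scaledWordSum_eq (y : Color) {r s t n : ℕ} (h : r + s + t = n + 1) :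
    scaledWordSum y r s t =
      var .q ^ ((n + 1) * levelDiff .a y + r + s) * ((1 - var .q ^ (2 * r)) *
        scaledWordSum .a (r - 1) s t) +
      var .q ^ ((n + 1) * levelDiff .b y + r + s) * ((1 - var .q ^ (2 * s)) *
        scaledWordSum .b r (s - 1) t) +
      var .q ^ ((n + 1) * levelDiff .u y) * ((1 - var .q ^ t) *
        scaledWordSum .u r s (t - 1)) := by
  have hc : ∀ k : ℕ, (k + 1 + 1).choose 2 = (k + 1).choose 2 + (k + 1) := by
    intro k
    rw [Nat.choose_succ_succ' (k + 1) 1]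
    simp [add_comm]
  have ha : qPoch (var .q ^ 2) (var .q ^ 2) r * var .q ^ (r + s + 1).choose 2 *
        (if r = 0 then 0 else wordSum .a (r - 1) s t) =
      var .q ^ (r + s) * (1 - var .q ^ (2 * r)) * (qPoch (var .q ^ 2) (var .q ^ 2) (r - 1) *
        var .q ^ (r - 1 + s + 1).choose 2 * wordSum .a (r - 1) s t) := by
    rcases r with _ | r
    · simp
    · rw [if_neg (Nat.succ_ne_zero r), Nat.add_sub_cancel, qPoch_succ,
        show r + 1 + s + 1 = r + s + 1 + 1 by ring, hc]
      ring
  have hb : qPoch (var .q ^ 2) (var .q ^ 2) s * var .q ^ (r + s + 1).choose 2 *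
        (if s = 0 then 0 else wordSum .b r (s - 1) t) =
      var .q ^ (r + s) * (1 - var .q ^ (2 * s)) * (qPoch (var .q ^ 2) (var .q ^ 2) (s - 1) *
        var .q ^ (r + (s - 1) + 1).choose 2 * wordSum .b r (s - 1) t) := by
    rcases s with _ | s
    · simp
    · rw [if_neg (Nat.succ_ne_zero s), Nat.add_sub_cancel, qPoch_succ,
        show r + (s + 1) + 1 = r + s + 1 + 1 by ring, hc]
      ring
  have hu : qPoch (var .q) (var .q) t * (if t = 0 then 0 else wordSum .u r s (t - 1)) =
      (1 - var .q ^ t) * (qPoch (var .q) (var .q) (t - 1) * wordSum .u r s (t - 1)) := by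
    rcases t with _ | t
    · simp
    · rw [if_neg (Nat.succ_ne_zero t), Nat.add_sub_cancel, qPoch_succ]
      ring
  simp only [scaledWordSum]
  rw [wordSum_eq y h]
  linear_combination
    qPoch (var .q) (var .q) t * qPoch (var .q ^ 2) (var .q ^ 2) s *
      var .q ^ ((n + 1) * levelDiff .a y) * ha +
    qPoch (var .q) (var .q) t * qPoch (var .q ^ 2) (var .q ^ 2) r *
      var .q ^ ((n + 1) * levelDiff .b y) * hb +
    qPoch (var .q ^ 2) (var .q ^ 2) r * qPoch (var .q ^ 2) (var .q ^ 2) s *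
      var .q ^ (r + s + 1).choose 2 * var .q ^ ((n + 1) * levelDiff .u y) * hu

/-- Removing the last letter makes it the new `y`, so the three formulas need a joint induction. The
third keeps the factor `1 + q^{r+s}` on the left because it equals 2, not a unit, at `r = s = 0`. -/
lemma scaledWordSum_closed (n : ℕ) : ∀ r s t, r + s + t = n →
    scaledWordSum .a r s t = var .q ^ (r ^ 2 + s ^ 2) * var .q ^ r *
      qPoch (var .q) (var .q) n * qPoch (-var .q) (var .q) (r + s) ∧
    scaledWordSum .b r s t = var .q ^ (r ^ 2 + s ^ 2) * var .q ^ s *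
      qPoch (var .q) (var .q) n * qPoch (-var .q) (var .q) (r + s) ∧
    (1 + var .q ^ (r + s)) * scaledWordSum .u r s t = var .q ^ (r ^ 2 + s ^ 2) *
      var .q ^ (r + s) * (var .q ^ r + var .q ^ s) *
      qPoch (var .q) (var .q) n * qPoch (-var .q) (var .q) (r + s) := by
  induction n with
  | zero =>
    intro r s t h
    obtain ⟨rfl, rfl, rfl⟩ : r = 0 ∧ s = 0 ∧ t = 0 := by omega
    simp [scaledWordSum, wordSum_zero, qPoch_zero]
  | succ n ih =>
    intro r s t h
    have hU : (1 + var .q ^ (r + s)) * ((1 - var .q ^ t) * scaledWordSum .u r s (t - 1)) =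
        (1 - var .q ^ t) * (var .q ^ (r ^ 2 + s ^ 2) * var .q ^ (r + s) * (var .q ^ r + var .q ^ s) *
          qPoch (var .q) (var .q) n * qPoch (-var .q) (var .q) (r + s)) := by
      rcases t with _ | t
      · simp
      · rw [Nat.add_sub_cancel, ← (ih r s t (by omega)).2.2]
        ring
    -- Splitting `1 + q^{r+s}` off `(-q)_{r+s}` requires `r + s > 0`.
    rcases Nat.eq_zero_or_pos (r + s) with hm | hm
    · obtain ⟨rfl, rfl⟩ : r = 0 ∧ s = 0 := by omega
      obtain rfl : t = n + 1 := by omega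
      have hU' : (1 - var .q ^ (n + 1)) * scaledWordSum .u 0 0 (n + 1 - 1) =
          qPoch (var .q) (var .q) (n + 1) := by
        apply mul_left_cancel₀ (one_add_q_pow_ne_zero (0 + 0))
        rw [hU, qPoch_zero, qPoch_succ]
        ring
      have hY : ∀ y, scaledWordSum y 0 0 (n + 1) = qPoch (var .q) (var .q) (n + 1) := by
        intro y
        rw [scaledWordSum_eq y h, hU']
        cases y <;> simp [levelDiff]
      simp only [hY, add_zero, qPoch_zero]
      refine ⟨by ring, by ring, by ring⟩
    · obtain ⟨m, hm⟩ : ∃ m, r + s = m + 1 := ⟨r + s - 1, by omega⟩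
      -- The factor `q^r` restores the square: `(r-1)^2 + (r-1) + r = r^2`.
      have hA : var .q ^ r * ((1 - var .q ^ (2 * r)) * scaledWordSum .a (r - 1) s t) =
          (1 - var .q ^ (2 * r)) * (var .q ^ (r ^ 2 + s ^ 2) *
            qPoch (var .q) (var .q) n * qPoch (-var .q) (var .q) m) := by
        rcases r with _ | r
        · simp
        · rw [Nat.add_sub_cancel, (ih r s t (by omega)).1, show r + s = m by omega]
          ring
      have hB : var .q ^ s * ((1 - var .q ^ (2 * s)) * scaledWordSum .b r (s - 1) t) =
          (1 - var .q ^ (2 * s)) * (var .q ^ (r ^ 2 + s ^ 2) *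
            qPoch (var .q) (var .q) n * qPoch (-var .q) (var .q) m) := by
        rcases s with _ | s
        · simp
        · rw [Nat.add_sub_cancel, (ih r s t (by omega)).2.1, show r + s = m by omega]
          ring
      have hpoch : qPoch (-var .q) (var .q) (r + s) =
          (1 + var .q ^ (r + s)) * qPoch (-var .q) (var .q) m := by
        rw [hm, qPoch_succ]
        ring
      have hU' : (1 - var .q ^ t) * scaledWordSum .u r s (t - 1) =
          (1 - var .q ^ t) * (var .q ^ (r ^ 2 + s ^ 2) * var .q ^ (r + s) *
            (var .q ^ r + var .q ^ s) * qPoch (var .q) (var .q) n *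
            qPoch (-var .q) (var .q) m) := by
        apply mul_left_cancel₀ (one_add_q_pow_ne_zero (r + s))
        rw [hU, hpoch]
        ring
      have hN : var .q ^ (n + 1) = var .q ^ r * var .q ^ s * var .q ^ t := by
        rw [← h, pow_add, pow_add]
      have hNp : qPoch (var .q) (var .q) (n + 1) =
          qPoch (var .q) (var .q) n * (1 - var .q ^ r * var .q ^ s * var .q ^ t) := by
        rw [qPoch_succ, ← pow_succ', hN]
      rw [hpoch, hNp, scaledWordSum_eq .a h, scaledWordSum_eq .b h, scaledWordSum_eq .u h, hU']
      simp only [levelDiff]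
      rw [mul_zero, zero_add, mul_one, pow_add _ (n + 1 + r), pow_add _ (n + 1), hN, pow_zero]
      -- Since `q^{n+1} = q^r q^s q^t`, only polynomial identities in `q^r`, `q^s`, `q^t` remain
      -- after substituting `hA` and `hB`.
      simp only [pow_add _ r s, mul_comm 2, pow_mul] at *
      refine ⟨?_, ?_, ?_⟩
      · linear_combination (var .q ^ s * (var .q ^ r * var .q ^ s * var .q ^ t)) * hA +
          var .q ^ r * hB
      · linear_combination var .q ^ s * hA +
          (var .q ^ r * (var .q ^ r * var .q ^ s * var .q ^ t)) * hB
      · linear_combination (1 + var .q ^ r * var .q ^ s) *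
          ((var .q ^ s * (var .q ^ r * var .q ^ s * var .q ^ t)) * hA +
          (var .q ^ r * (var .q ^ r * var .q ^ s * var .q ^ t)) * hB)

end ClosedForm

/-! ### Summation over codes, words and letter counts. -/

section Assembly

lemma length_decode (cs : List Code) : (decode cs).length = (cs.map Prod.fst).length := by
  induction cs with
  | nil => rfl
  | cons z cs ih => simp [decode, ih]

lemma colorCount_decode (c : Color) (cs : List Code) :
    colorCount c (decode cs) = (cs.map Prod.fst).count c := by
  induction cs with
  | nil => rfl
  | cons z cs ih =>
    rw [decode, colorCount, List.countP_cons, ← colorCount, ih, List.map_cons, List.count_cons]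
    simp

lemma hasSum_codeTerm :
    HasSum (fun cs : List Code =>
      codeTerm ((cs.map Prod.fst).length - (cs.map Prod.fst).count .u) 1 cs) genFun₃ := by
  classical
  have h := (decode_injective.hasSum_iff (fun l hl =>
    if_neg fun h => hl h.1.exists_decode)).2 hasSum_partsMonomial
  convert! h using 1
  funext cs
  rw [codeTerm_eq _ 0, Function.comp_apply]
  simp only [isJaggedOverpartition_decode, true_and, zero_mul, pow_zero, one_mul,
    FinalPartsOverlined, Nat.sub_zero, length_decode, colorCount_decode]

lemma prod_map_colorWeight (w : List Color) :
    (w.map colorWeight).prod = var .a ^ w.count .a * (var .b * var .q) ^ w.count .b := by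
  induction w with
  | nil => simp
  | cons x w ih =>
    rw [List.map_cons, List.prod_cons, ih]
    cases x <;> simp [colorWeight] <;> ring

/-- The sum of the monomials of all jagged overpartitions with color word `w` whose parts of
position greater than `m` are overlined. -/
noncomputable def wordTerm (m : ℕ) (w : List Color) : Series :=
  var .q ^ wordStat .a 1 w * (w.map colorWeight).prod *
    ∏ i ∈ Finset.range w.length, positionFactor m (1 + i)

lemma hasSum_wordTerm :
    HasSum (fun w : List Color => wordTerm (w.length - w.count .u) w) genFun₃ := by
  have h := (Equiv.sigmaFiberEquiv fun cs : List Code => cs.map Prod.fst).hasSum_iff.2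
    hasSum_codeTerm
  refine h.sigma fun w => ?_
  convert! hasSum_codeTerm_fiber (w.length - w.count .u) one_ne_zero w using 1
  funext cs
  simp only [Function.comp_apply, Equiv.sigmaFiberEquiv_apply, cs.2]

/-- The sum of the monomials of all jagged overpartitions counted by `genFun₃` with `r`, `s` and
`t` parts of color `a`, `b` and `u`. -/
noncomputable def contentTerm (r s t : ℕ) : Series :=
  var .a ^ r * (var .b * var .q) ^ s *
    (∏ i ∈ Finset.range (r + s + t), positionFactor (r + s) (1 + i)) * wordSum .a r s t

lemma hasSum_contentTerm :
    HasSum (fun p : (ℕ × ℕ) × ℕ => contentTerm p.1.1 p.1.2 p.2) genFun₃ := by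
  have h := (Equiv.sigmaFiberEquiv fun w : List Color =>
    ((w.count .a, w.count .b), w.count .u)).hasSum_iff.2 hasSum_wordTerm
  refine h.sigma fun p => ?_
  obtain ⟨⟨r, s⟩, t⟩ := p
  let e : {w : List Color // ((w.count .a, w.count .b), w.count .u) = ((r, s), t)} ≃
      wordSet r s t :=
    Equiv.subtypeEquivRight fun w => by simp [wordSet, and_assoc]
  rw [← e.symm.hasSum_iff]
  convert! (hasSum_wordSum .a r s t).mul_left (var .a ^ r * (var .b * var .q) ^ s *
    (∏ i ∈ Finset.range (r + s + t), positionFactor (r + s) (1 + i))) using 1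
  funext w
  have hw := length_eq_count w.1
  have hw1 := w.2.1
  have hw2 := w.2.2.1
  have hw3 := w.2.2.2
  have he : (e.symm w).1 = w.1 := rfl
  simp only [Function.comp_apply, Equiv.sigmaFiberEquiv_apply, he, wordTerm,
    prod_map_colorWeight, hw, hw1, hw2, hw3, Nat.add_sub_cancel]
  ring

/-- The first `m` numerators are `d + q^k`. The last `t` are the powers `q^{m+1}, …, q^{m+t}`, and
the denominators multiply to `(q)_{m+t}`. -/
lemma prod_positionFactor (m t : ℕ) :
    (∏ i ∈ Finset.range (m + t), positionFactor m (1 + i)) * qPoch (var .q) (var .q) (m + t) =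
      qPochScaled (var .d) (-var .q) (var .q) m * var .q ^ ((t + 1).choose 2 + m * t) := by
  induction t with
  | zero =>
    rw [add_zero, qPoch, ← Finset.prod_mul_distrib, qPochScaled]
    simp only [zero_add, mul_zero, Nat.choose_eq_zero_of_lt one_lt_two, pow_zero, mul_one]
    refine Finset.prod_congr rfl fun i hi => ?_
    have hi' : 1 + i ≤ m := by
      rw [add_comm]
      exact Finset.mem_range.1 hi
    have hq : qFactor (var .q) (var .q) i = 1 - var .q ^ (1 + i) := by
      rw [qFactor, pow_add, pow_one]
    rw [positionFactor, if_pos hi', hq, mul_assoc,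
      Ring.inverse_mul_cancel _ (isUnit_one_sub_q_pow (by omega))]
    ring
  | succ t ih =>
    have h1 : ¬ 1 + (m + t) ≤ m := by omega
    have h2 : (t + 1 + 1).choose 2 = (t + 1).choose 2 + (t + 1) := by
      rw [Nat.choose_succ_succ' (t + 1) 1]
      simp [add_comm]
    have h3 := Ring.inverse_mul_cancel _ (isUnit_one_sub_q_pow (k := 1 + (m + t)) (by omega))
    rw [← add_assoc, Finset.prod_range_succ, qPoch_succ, positionFactor, if_neg h1, add_zero, h2,
      ← pow_succ', add_comm (m + t) 1]
    calc _ = (∏ i ∈ Finset.range (m + t), positionFactor m (1 + i)) *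
          qPoch (var .q) (var .q) (m + t) * var .q ^ (1 + (m + t)) *
          (Ring.inverse (1 - var .q ^ (1 + (m + t))) * (1 - var .q ^ (1 + (m + t)))) := by ring
      _ = _ := by
        rw [h3, ih]
        ring

lemma contentTerm_eq (r s t : ℕ) :
    contentTerm r s t =
      summand (r, s) * (qPoch (-var .q) (var .q) (r + s) * eulerTerm (r + s) t) := by
  have h1 := prod_positionFactor (r + s) t
  have h2 := (scaledWordSum_closed _ r s t rfl).1
  have h3 := Ring.inverse_mul_cancel _ ((isUnit_qPoch r).mul (isUnit_qPoch s))
  have h4 := Ring.inverse_mul_cancel _ (isUnit_qPoch_q t)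
  -- The factor `q^s` comes from `(bq)^s`, the rest from the closed form with `y = a`.
  have h5 : var .q ^ (r ^ 2 + s ^ 2) * var .q ^ r * var .q ^ s =
      var .q ^ (r ^ 2 + r + s ^ 2 + s - (r + s + 1).choose 2) *
        var .q ^ (r + s + 1).choose 2 := by
    rw [← pow_add, ← pow_add, ← pow_add, Nat.sub_add_cancel (choose_le_exponent r s)]
    ring
  -- The common denominator, including the power of `q` absorbed into `scaledWordSum`.
  have hD : qPoch (var .q) (var .q) (r + s + t) * (qPoch (var .q) (var .q) t *
      (qPoch (var .q ^ 2) (var .q ^ 2) r * qPoch (var .q ^ 2) (var .q ^ 2) s) *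
      var .q ^ (r + s + 1).choose 2) ≠ 0 :=
    mul_ne_zero (isUnit_qPoch_q _).ne_zero (mul_ne_zero (mul_ne_zero (isUnit_qPoch_q _).ne_zero
      ((isUnit_qPoch r).mul (isUnit_qPoch s)).ne_zero) (pow_ne_zero _ var_q_ne_zero))
  apply mul_right_cancel₀ hD
  simp only [contentTerm, summand, eulerTerm, scaledWordSum] at *
  generalize (∏ i ∈ Finset.range (r + s + t), positionFactor (r + s) (1 + i)) = F at *
  generalize qPochScaled (var .d) (-var .q) (var .q) (r + s) = S at *
  generalize qPoch (var .q) (var .q) (r + s + t) = N at *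
  generalize qPoch (-var .q) (var .q) (r + s) = M at *
  generalize Ring.inverse (qPoch (var .q ^ 2) (var .q ^ 2) r *
    qPoch (var .q ^ 2) (var .q ^ 2) s) = I at *
  generalize Ring.inverse (qPoch (var .q) (var .q) t) = J at *
  generalize qPoch (var .q) (var .q) t = T at *
  generalize qPoch (var .q ^ 2) (var .q ^ 2) r = R at *
  generalize qPoch (var .q ^ 2) (var .q ^ 2) s = S' at *
  generalize var .q ^ (r ^ 2 + r + s ^ 2 + s - (r + s + 1).choose 2) = X at *
  generalize var .q ^ (r + s + 1).choose 2 = C at *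
  generalize var .q ^ ((t + 1).choose 2 + (r + s) * t) = Y at *
  generalize var .q ^ (r ^ 2 + s ^ 2) = E at *
  generalize wordSum .a r s t = W at *
  rw [mul_pow]
  generalize var .q ^ r = q₁ at *
  generalize var .q ^ s = q₂ at *
  generalize var .a ^ r = a₁ at *
  generalize var .b ^ s = b₁ at *
  calc _ = a₁ * b₁ * q₂ * (F * N) * (T * R * S' * C * W) := by ring
    _ = a₁ * b₁ * (S * Y) * (E * q₁ * q₂) * N * M := by rw [h1, h2]; ring
    _ = a₁ * b₁ * (S * Y) * (X * C) * N * M * (I * (R * S')) * (J * T) := by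
      rw [h5, h3, h4]; ring
    _ = _ := by ring

lemma hasSum_qPochInf_mul_summand :
    HasSum (fun p : ℕ × ℕ => qPochInf (-var .q) (var .q) * summand p) genFun₃ := by
  refine hasSum_contentTerm.prod_fiberwise fun p => ?_
  simp only [contentTerm_eq]
  rw [mul_comm]
  exact (hasSum_eulerTerm (p.1 + p.2)).mul_left (summand p)

end Assembly

end JaggedOverpartition

theorem mainTheorem3 :
    Multipliable (JaggedOverpartition.qFactor
      (-JaggedOverpartition.var .q) (JaggedOverpartition.var .q)) ∧
    Summable JaggedOverpartition.summand ∧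
    JaggedOverpartition.genFun₃ =
      JaggedOverpartition.qPochInf (-JaggedOverpartition.var .q) (JaggedOverpartition.var .q) *
        ∑' p : ℕ × ℕ, JaggedOverpartition.summand p := by
  have h := JaggedOverpartition.hasSum_qPochInf_mul_summand
  have hs : Summable JaggedOverpartition.summand := by
    have h' := (h.mul_left (Ring.inverse (JaggedOverpartition.qPochInf
      (-JaggedOverpartition.var .q) (JaggedOverpartition.var .q)))).summable
    simpa only [← mul_assoc, one_mul,
      Ring.inverse_mul_cancel _ JaggedOverpartition.isUnit_qPochInf] using h'
  exact ⟨JaggedOverpartition.multipliable_qFactor, hs, h.unique (hs.hasSum.mul_left _)⟩
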